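/- Time is integral: release times, execution times, deadlines and periods are integers. Let $\tau=\{\tau_1,\dots,\tau_n\}$ be a set of sporadic DAG tasks with implicit deadlines, to be scheduled on $M\ge 1$ identical processors. Task $\tau_i$ has a period $p_i\ge 1$ and a finite directed acyclic graph of subtasks $\tau_i^v$ with worst-case execution times $e_i^v\ge 1$. It releases an infinite sequence of dag-jobs, consecutive release times being at least $p_i$ apart. A dag-job released at time $r$ has absolute deadline $r+p_i$ and consists of one job of each subtask of $\tau_i$, and the job of $\tau_i^v$ needs at least one and at most $e_i^v$ units of execution. A job that has been released and has not completed is ready once the jobs of all predecessor subtasks in its dag-job, and all earlier dag-jobs of its task, have completed. For every $i$ fix a critical path of $\tau_i$, that is, a chain of subtasks (consecutive ones joined by an edge) that maximizes the sum of the worst-case execution times; let $L_i$ be this sum, and let $\sigma_i=L_i/p_i$ be the cp-utilization. Let $C_i=\sum_v e_i^v$ and $u_i=C_i/p_i$. CP-GEDF is preemptive global EDF with the Lazy-Cpath rule. In each unit interval $[t,t+1)$ at most $M$ jobs execute, all of them ready at $t$; a ready job waits only if $M$ jobs execute and it has higher priority than none of them. A job has higher priority than another one if its absolute deadline is earlier;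 or the deadlines are equal and its task has the lower index; or both jobs belong to the same dag-job, it is not on the critical path and the other job is. All remaining choices are arbitrary. For tasks $\tau_h$ and $\tau_i$ let $$\eta_i^{(h)}=\begin{cases}u_i, & \sigma_h\ge u_i,\\[2pt] u_i+\dfrac{C_i-\sigma_h\,p_i}{p_h}, & \sigma_h<u_i.\end{cases}$$ **Theorem.** If $$\sum_{i=1}^n \eta_i^{(k)}\le M-(M-1)\,\sigma_k\qquad\text{for every } k\in\{1,\dots,n\},$$ then $\tau$ is schedulable on $M$ processors under CP-GEDF: for all release times and execution times as above, in every CP-GEDF schedule every dag-job completes by its deadline. -/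

import Mathlib

universe u

namespace CPGEDF

/-- A sporadic DAG task: a finite directed acyclic graph of subtasks with worst-case execution
times, a relative deadline and a period (minimum inter-release separation). Time is integral. -/
structure DagTask where
  Subtask : Type u
  [fintypeSubtask : Fintype Subtask]
  /-- `edge v w`: the subtask `v` is a (direct) predecessor of the subtask `w`. -/
  edge : Subtask → Subtask → Prop
  acyclic : ∀ v, ¬ Relation.TransGen edge v v
  wcet : Subtask → ℕ
  wcet_pos : ∀ v, 0 < wcet v
  relDeadline : ℕ
  period : ℕ
  period_pos : 0 < period

attribute [instance] DagTask.fintypeSubtask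

namespace DagTask

/-- A chain: a sequence of subtasks in which consecutive ones are joined by an edge. -/
def IsChain (T : DagTask.{u}) (l : List T.Subtask) : Prop := l.IsChain T.edge

/-- The length of a chain: the sum of the worst-case execution times along it. -/
def chainLength (T : DagTask.{u}) (l : List T.Subtask) : ℕ := (l.map T.wcet).sum

/-- A critical path: a chain of maximal length. -/
def IsCriticalPath (T : DagTask.{u}) (l : List T.Subtask) : Prop :=
  T.IsChain l ∧ ∀ l', T.IsChain l' → T.chainLength l' ≤ T.chainLength l

/-- The total execution time `C` of the DAG. -/
def totalExec (T : DagTask.{u}) : ℕ := ∑ v, T.wcet v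

/-- The utilization `u = C / p`. -/
noncomputable def utilization (T : DagTask.{u}) : ℝ := (T.totalExec : ℝ) / (T.period : ℝ)

/-- The cp-utilization `σ = len(cp) / p`, where `cp` is the selected critical path. -/
noncomputable def cpUtilization (T : DagTask.{u}) (cp : List T.Subtask) : ℝ :=
  (T.chainLength cp : ℝ) / (T.period : ℝ)

end DagTask

/-- The term `η_i` relative to the task `τ_h`; `cp` gives the selected critical path of every
task. -/
noncomputable def eta {n : ℕ} (τ : Fin n → DagTask.{u}) (cp : ∀ i, List (τ i).Subtask)
    (h i : Fin n) : ℝ :=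
  if (τ i).utilization ≤ (τ h).cpUtilization (cp h) then (τ i).utilization
  else (τ i).utilization +
    (((τ i).totalExec : ℝ) - (τ h).cpUtilization (cp h) * ((τ i).period : ℝ)) /
      ((τ h).period : ℝ)

/-- A job: the `index`-th instance of a subtask of a task. The jobs with the same task and index
form a dag-job. -/
structure Job {n : ℕ} (τ : Fin n → DagTask.{u}) where
  task : Fin n
  index : ℕ
  subtask : (τ task).Subtask

/-- A run-time behaviour of the task set: every task releases an infinite sequence of dag-jobs
separated by at least its period, and every job needs at most its worst-case execution time. -/
structure Behaviour {n : ℕ} (τ : Fin n → DagTask.{u}) where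
  release : Fin n → ℕ → ℕ
  separated : ∀ i j, release i j + (τ i).period ≤ release i (j + 1)
  exec : Job τ → ℕ
  exec_pos : ∀ J, 0 < exec J
  exec_le_wcet : ∀ J, exec J ≤ (τ J.task).wcet J.subtask

/-- A schedule: `S t` is the set of jobs that execute, each on its own processor, during the
whole unit interval `[t, t + 1)`. Preemption and migration are free. -/
abbrev Schedule {n : ℕ} (τ : Fin n → DagTask.{u}) := ℕ → Finset (Job τ)

section
variable {n : ℕ} {τ : Fin n → DagTask.{u}}

/-- The absolute deadline of the dag-job `(i, j)`. -/
def Behaviour.deadline (B : Behaviour τ) (i : Fin n) (j : ℕ) : ℕ :=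
  B.release i j + (τ i).relDeadline

open Classical in
/-- The amount of execution that the job `J` has received before time `t`. -/
noncomputable def service (S : Schedule τ) (J : Job τ) (t : ℕ) : ℕ :=
  ((Finset.range t).filter (fun s => J ∈ S s)).card

/-- The job `J` has completed by time `t`. -/
def JobCompleted (B : Behaviour τ) (S : Schedule τ) (J : Job τ) (t : ℕ) : Prop :=
  B.exec J ≤ service S J t

/-- The dag-job `(i, j)` has completed by time `t`. -/
def DagJobCompleted (B : Behaviour τ) (S : Schedule τ) (i : Fin n) (j t : ℕ) : Prop :=
  ∀ v : (τ i).Subtask, JobCompleted B S ⟨i, j, v⟩ t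

/-- The job `J` is ready at time `t`: it is released and not complete, its predecessor jobs are
complete, and so are the earlier dag-jobs of its task (dag-jobs of one task execute in
sequence). -/
def Ready (B : Behaviour τ) (S : Schedule τ) (J : Job τ) (t : ℕ) : Prop :=
  B.release J.task J.index ≤ t ∧
  ¬ JobCompleted B S J t ∧
  (∀ v, (τ J.task).edge v J.subtask → JobCompleted B S ⟨J.task, J.index, v⟩ t) ∧
  (∀ j, j < J.index → DagJobCompleted B S J.task j t)

/-- `J` has strictly higher priority than `J'`: earlier absolute deadline first; then lower task
ID; and inside one dag-job, jobs off the critical path precede jobs on the critical path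
(the Lazy-Cpath rule). Jobs left incomparable may be ordered arbitrarily, at every instant. -/
def HigherPriority (B : Behaviour τ) (cp : ∀ i, List (τ i).Subtask) (J J' : Job τ) : Prop :=
  B.deadline J.task J.index < B.deadline J'.task J'.index ∨
  (B.deadline J.task J.index = B.deadline J'.task J'.index ∧
    (J.task < J'.task ∨
      (J.task = J'.task ∧ J.subtask ∉ cp J.task ∧ J'.subtask ∈ cp J'.task)))

/-- `S` is a schedule that CP-GEDF can produce on `M` identical processors. -/
structure IsCPGEDFSchedule (M : ℕ) (cp : ∀ i, List (τ i).Subtask) (B : Behaviour τ)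
    (S : Schedule τ) : Prop where
  ready : ∀ t, ∀ J ∈ S t, Ready B S J t
  card_le : ∀ t, (S t).card ≤ M
  /-- A ready job waits only if all processors execute jobs over which it has no priority. -/
  waiting : ∀ t J, Ready B S J t → J ∉ S t →
    (S t).card = M ∧ ∀ J' ∈ S t, ¬ HigherPriority B cp J J'

end

/-- Hard real-time schedulability under CP-GEDF on `M` processors: whatever the behaviour of the
task set and the remaining choices of the scheduler, every dag-job completes by its deadline. -/
def Schedulable {n : ℕ} (M : ℕ) (τ : Fin n → DagTask.{u}) (cp : ∀ i, List (τ i).Subtask) :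
    Prop :=
  ∀ (B : Behaviour τ) (S : Schedule τ), IsCPGEDFSchedule M cp B S →
    ∀ i j, DagJobCompleted B S i j (B.deadline i j)

end CPGEDF

/-! Let `d` be the earliest missed deadline, missed by a dag-job of `τ k`. Let W(t) be the work with
deadline at most `d` left at t, and μ = M - (M-1)σ_k. Call a slot slack if fewer than M such urgent
jobs run in it. A pending urgent dag-job progresses in every slack slot (`slack_le_sum_service`),
and a chain of its subtasks accounts for all of them (`slack_lt_chainLength`). So the window of the
missed dag-job has fewer than L_k slack slots, which forces W(t) > μ(d - t) at its release.

Take the earliest t with this inequality and put Δ = d - t. If an urgent dag-job of `τ i` released φ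
before t is pending at t, minimality says that W fell by less than μφ meanwhile. Hence more than σ_k
φ slots were slack and the dag-job received more than σ_k φ units. So `τ i` contributes at most
u_i(Δ + φ) - σ_k φ ≤ η_i Δ (`demand_le_eta_mul`, `le_eta_mul`). Summing over i, the test gives W(t)
≤ μΔ, a contradiction. -/

namespace CPGEDF

section
variable {n : ℕ} {τ : Fin n → DagTask.{u}} {B : Behaviour τ} {S : Schedule τ} {M : ℕ}
  {cp : ∀ i, List (τ i).Subtask}

/-! ### Service and remaining execution -/

open Classical in
theorem service_succ (S : Schedule τ) (J : Job τ) (t : ℕ) :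
    service S J (t + 1) = service S J t + if J ∈ S t then 1 else 0 := by
  unfold service
  rw [Finset.range_add_one, Finset.filter_insert]
  split_ifs with h
  · rw [Finset.card_insert_of_notMem (by simp)]
  · rfl

theorem service_mono (S : Schedule τ) (J : Job τ) : Monotone (service S J) := by
  classical
  exact monotone_nat_of_le_succ fun t => by rw [service_succ]; omega

theorem JobCompleted.mono {J : Job τ} {s t : ℕ} (h : JobCompleted B S J s) (hst : s ≤ t) :
    JobCompleted B S J t :=
  le_trans h (service_mono S J hst)

theorem DagJobCompleted.mono {i : Fin n} {j s t : ℕ} (h : DagJobCompleted B S i j s)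
    (hst : s ≤ t) : DagJobCompleted B S i j t :=
  fun v => (h v).mono hst

/-- Only incomplete jobs execute, so none overruns; this makes the truncated subtraction in
`remaining` exact. -/
theorem service_le_exec (hS : IsCPGEDFSchedule M cp B S) (J : Job τ) (t : ℕ) :
    service S J t ≤ B.exec J := by
  classical
  induction t with
  | zero => simp [service]
  | succ t ih =>
    rw [service_succ]
    split_ifs with h
    · have := (hS.ready t J h).2.1
      unfold JobCompleted at this
      omega
    · simpa using ih

/-- The execution that the job `J` still needs at time `t`. -/
noncomputable def remaining (B : Behaviour τ) (S : Schedule τ) (J : Job τ) (t : ℕ) : ℕ :=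
  B.exec J - service S J t

theorem remaining_add_service (hS : IsCPGEDFSchedule M cp B S) (J : Job τ) (t : ℕ) :
    remaining B S J t + service S J t = B.exec J :=
  Nat.sub_add_cancel (service_le_exec hS J t)

open Classical in
theorem remaining_eq_succ (hS : IsCPGEDFSchedule M cp B S) (J : Job τ) (t : ℕ) :
    remaining B S J t = remaining B S J (t + 1) + if J ∈ S t then 1 else 0 := by
  have h₁ := remaining_add_service hS J t
  have h₂ := remaining_add_service hS J (t + 1)
  rw [service_succ] at h₂
  omega

theorem jobCompleted_iff_remaining_eq_zero {J : Job τ} {t : ℕ} :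
    JobCompleted B S J t ↔ remaining B S J t = 0 := by
  unfold JobCompleted remaining
  omega

/-- The execution that the dag-job `(i, j)` still needs at time `t`. -/
noncomputable def dagRemaining (B : Behaviour τ) (S : Schedule τ) (i : Fin n) (j t : ℕ) : ℕ :=
  ∑ v, remaining B S ⟨i, j, v⟩ t

theorem dagJobCompleted_iff_dagRemaining_eq_zero {i : Fin n} {j t : ℕ} :
    DagJobCompleted B S i j t ↔ dagRemaining B S i j t = 0 := by
  simp [DagJobCompleted, dagRemaining, jobCompleted_iff_remaining_eq_zero]

theorem dagRemaining_add_sum_service_le (hS : IsCPGEDFSchedule M cp B S) (i : Fin n) (j t : ℕ) :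
    dagRemaining B S i j t + ∑ v, service S ⟨i, j, v⟩ t ≤ (τ i).totalExec := by
  unfold dagRemaining DagTask.totalExec
  rw [← Finset.sum_add_distrib]
  refine Finset.sum_le_sum fun v _ => ?_
  rw [remaining_add_service hS]
  exact B.exec_le_wcet ⟨i, j, v⟩

/-! ### Urgent demand -/

/-- The dag-jobs of task `i` with absolute deadline at most `d`; their indices are less than
`d`. -/
def urgentIndices (B : Behaviour τ) (d : ℕ) (i : Fin n) : Finset ℕ :=
  (Finset.range d).filter fun j => B.deadline i j ≤ d

/-- The execution that the dag-jobs of task `i` with deadline at most `d` still need at `t`. -/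
noncomputable def demand (B : Behaviour τ) (S : Schedule τ) (d : ℕ) (i : Fin n) (t : ℕ) : ℕ :=
  ∑ j ∈ urgentIndices B d i, dagRemaining B S i j t

/-- The number of jobs with deadline at most `d` that execute in `[t, t + 1)`. -/
def urgentCount (B : Behaviour τ) (S : Schedule τ) (d t : ℕ) : ℕ :=
  ((S t).filter fun J => B.deadline J.task J.index ≤ d).card

theorem release_add_mul_le (B : Behaviour τ) (i : Fin n) (j m : ℕ) :
    B.release i j + m * (τ i).period ≤ B.release i (j + m) := by
  induction m with
  | zero => simp
  | succ m ih =>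
    have := B.separated i (j + m)
    rw [← add_assoc, add_mul]
    omega

theorem release_add_period_le (B : Behaviour τ) (i : Fin n) {j j' : ℕ} (h : j < j') :
    B.release i j + (τ i).period ≤ B.release i j' := by
  obtain ⟨m, rfl⟩ := Nat.exists_eq_add_of_lt h
  have := release_add_mul_le B i j (m + 1)
  rw [add_mul] at this
  rw [add_assoc]
  omega

/-- Periods are at least 1, so dag-job `j` has deadline at least `j + 1`: the cutoff `range d` loses
nothing. -/
theorem mem_urgentIndices (himplicit : ∀ i, (τ i).relDeadline = (τ i).period) {d : ℕ} {i : Fin n}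
    {j : ℕ} : j ∈ urgentIndices B d i ↔ B.deadline i j ≤ d := by
  simp only [urgentIndices, Finset.mem_filter, Finset.mem_range, and_iff_right_iff_imp]
  intro h
  have h₁ := release_add_mul_le B i 0 j
  have h₂ := Nat.le_mul_of_pos_right j (τ i).period_pos
  have h₃ := (τ i).period_pos
  rw [zero_add] at h₁
  rw [Behaviour.deadline, himplicit] at h
  omega

/-- Demand includes dag-jobs not yet released, so arrivals never raise it: it changes only through
execution. -/
theorem sum_demand_eq_succ (himplicit : ∀ i, (τ i).relDeadline = (τ i).period)
    (hS : IsCPGEDFSchedule M cp B S) (d t : ℕ) :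
    ∑ i, demand B S d i t = ∑ i, demand B S d i (t + 1) + urgentCount B S d t := by
  classical
  have hcount : urgentCount B S d t =
      ∑ i, ∑ j ∈ urgentIndices B d i, ∑ v, if (⟨i, j, v⟩ : Job τ) ∈ S t then 1 else 0 := by
    simp_rw [← Finset.sum_product', Finset.sum_sigma']
    rw [Finset.sum_boole, Nat.cast_id, urgentCount]
    refine Finset.card_nbij' (fun J => ⟨J.task, J.index, J.subtask⟩)
      (fun x => ⟨x.1, x.2.1, x.2.2⟩) ?_ ?_ ?_ ?_
    · intro J hJ
      have hJ := Finset.mem_filter.1 hJ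
      simpa [mem_urgentIndices himplicit] using hJ.symm
    · intro x hx
      simpa [mem_urgentIndices himplicit, and_comm] using hx
    · intro J _
      rfl
    · intro x _
      rfl
  rw [hcount, ← Finset.sum_add_distrib]
  refine Finset.sum_congr rfl fun i _ => ?_
  unfold demand dagRemaining
  rw [← Finset.sum_add_distrib]
  refine Finset.sum_congr rfl fun j _ => ?_
  rw [← Finset.sum_add_distrib]
  exact Finset.sum_congr rfl fun v _ => remaining_eq_succ hS _ t

/-- An incomplete released dag-job whose predecessors in its task are complete has a ready
job. -/
theorem exists_ready {i : Fin n} {j t : ℕ} (hr : B.release i j ≤ t)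
    (hprev : ∀ j' < j, DagJobCompleted B S i j' t) (hinc : ¬ DagJobCompleted B S i j t) :
    ∃ v, Ready B S ⟨i, j, v⟩ t := by
  have hirr : Std.Irrefl (Relation.TransGen (τ i).edge) := ⟨(τ i).acyclic⟩
  have hwf : WellFounded (Relation.TransGen (τ i).edge) :=
    Finite.wellFounded_of_trans_of_irrefl _
  have hne : {v | ¬ JobCompleted B S ⟨i, j, v⟩ t}.Nonempty := by
    simpa [DagJobCompleted, Set.Nonempty] using hinc
  -- A minimal incomplete subtask has only completed predecessors.
  obtain ⟨v, hv, hmin⟩ := hwf.has_min _ hne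
  refine ⟨v, hr, hv, fun w hw => ?_, hprev⟩
  by_contra hc
  exact hmin w hc (Relation.TransGen.single hw)

/-- A ready job with deadline at most `d` executes unless all processors execute jobs with
deadline at most `d`. -/
theorem Ready.mem_of_urgentCount_lt (hS : IsCPGEDFSchedule M cp B S) {J : Job τ} {d t : ℕ}
    (hJ : Ready B S J t) (hd : B.deadline J.task J.index ≤ d) (ht : urgentCount B S d t < M) :
    J ∈ S t := by
  by_contra hmem
  obtain ⟨hcard, hprio⟩ := hS.waiting t J hJ hmem
  refine ht.ne ?_
  rw [urgentCount, Finset.filter_true_of_mem, hcard]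
  intro J' hJ'
  by_contra hlt
  exact hprio J' hJ' (Or.inl (by omega))

/-! ### Slots with slack -/

/-- The number of time slots in `[a, b)` in which some processor executes no job with deadline at
most `d`. -/
def slack (M : ℕ) (B : Behaviour τ) (S : Schedule τ) (d a b : ℕ) : ℕ :=
  ((Finset.Ico a b).filter fun t => urgentCount B S d t < M).card

theorem slack_self (d a : ℕ) : slack M B S d a a = 0 := by simp [slack]

theorem slack_succ {a b : ℕ} (d : ℕ) (hab : a ≤ b) :
    slack M B S d a (b + 1) =
      slack M B S d a b + if urgentCount B S d b < M then 1 else 0 := by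
  unfold slack
  rw [← Finset.insert_Ico_right_eq_Ico_add_one hab, Finset.filter_insert]
  split_ifs with h
  · rw [Finset.card_insert_of_notMem (by simp)]
  · rfl

/-- While a dag-job with deadline at most `d` is pending, the slots with slack execute some of
its jobs. -/
theorem exists_mem_of_urgentCount_lt (hS : IsCPGEDFSchedule M cp B S) {i : Fin n} {j d t : ℕ}
    (hr : B.release i j ≤ t) (hd : B.deadline i j ≤ d)
    (hprev : ∀ j' < j, DagJobCompleted B S i j' (B.release i j))
    (hinc : ¬ DagJobCompleted B S i j t) (ht : urgentCount B S d t < M) :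
    ∃ v, (⟨i, j, v⟩ : Job τ) ∈ S t := by
  obtain ⟨v, hv⟩ := exists_ready hr (fun j' hj' => (hprev j' hj').mono hr) hinc
  exact ⟨v, hv.mem_of_urgentCount_lt hS hd ht⟩

theorem slack_le_sum_service (hS : IsCPGEDFSchedule M cp B S) {i : Fin n} {j d b : ℕ}
    (hd : B.deadline i j ≤ d) (hprev : ∀ j' < j, DagJobCompleted B S i j' (B.release i j))
    (hb : B.release i j ≤ b) (hinc : ¬ DagJobCompleted B S i j b) :
    slack M B S d (B.release i j) b ≤ ∑ v, service S ⟨i, j, v⟩ b := by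
  classical
  induction b, hb using Nat.le_induction with
  | base => simp [slack_self]
  | succ b hb ih =>
    have hinc' : ¬ DagJobCompleted B S i j b := fun h => hinc (h.mono b.le_succ)
    have ih := ih hinc'
    simp_rw [slack_succ d hb, service_succ, Finset.sum_add_distrib]
    refine add_le_add ih ?_
    split_ifs with h
    · obtain ⟨v, hv⟩ := exists_mem_of_urgentCount_lt hS hb hd hprev hinc' h
      refine le_trans (by simp [hv]) (Finset.single_le_sum
        (f := fun v => if (⟨i, j, v⟩ : Job τ) ∈ S b then 1 else 0) (fun _ _ => Nat.zero_le _)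
        (Finset.mem_univ v))
    · exact Nat.zero_le _

/-- While a dag-job with deadline at most `d` is pending in `[a, b)`, the demand decreases by at
least `M` in a slot without slack and by at least one in a slot with slack. -/
theorem sum_demand_add_le (himplicit : ∀ i, (τ i).relDeadline = (τ i).period)
    (hS : IsCPGEDFSchedule M cp B S) {i : Fin n} {j d b : ℕ}
    (hd : B.deadline i j ≤ d) (hprev : ∀ j' < j, DagJobCompleted B S i j' (B.release i j))
    (hb : B.release i j ≤ b) (hinc : ¬ DagJobCompleted B S i j b) :
    ∑ i', demand B S d i' b + M * (b - B.release i j) + slack M B S d (B.release i j) b ≤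
      ∑ i', demand B S d i' (B.release i j) + M * slack M B S d (B.release i j) b := by
  induction b, hb using Nat.le_induction with
  | base => simp [slack_self]
  | succ b hb ih =>
    have hinc' : ¬ DagJobCompleted B S i j b := fun h => hinc (h.mono b.le_succ)
    have ih := ih hinc'
    rw [sum_demand_eq_succ himplicit hS d b] at ih
    rw [slack_succ d hb, Nat.sub_add_comm hb]
    split_ifs with h
    · obtain ⟨v, hv⟩ := exists_mem_of_urgentCount_lt hS hb hd hprev hinc' h
      have : 0 < urgentCount B S d b :=
        Finset.card_pos.2 ⟨_, Finset.mem_filter.2 ⟨hv, hd⟩⟩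
      rw [mul_add, mul_add]
      omega
    · rw [mul_add, add_zero]
      omega

/-- A pending job ends a chain of subtasks that accounts for all slots with slack since the
release of its dag-job. -/
theorem exists_chain_slack_le (hS : IsCPGEDFSchedule M cp B S) {i : Fin n} {j d b : ℕ}
    (hd : B.deadline i j ≤ d) (hprev : ∀ j' < j, DagJobCompleted B S i j' (B.release i j))
    (hb : B.release i j ≤ b) (v : (τ i).Subtask) (hinc : ¬ JobCompleted B S ⟨i, j, v⟩ b) :
    ∃ l, (τ i).IsChain (l ++ [v]) ∧
      slack M B S d (B.release i j) b ≤ (τ i).chainLength l + service S ⟨i, j, v⟩ b := by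
  classical
  induction b, hb using Nat.le_induction generalizing v with
  | base => exact ⟨[], by simp [DagTask.IsChain], by simp [slack_self]⟩
  | succ b hb ih =>
    rw [slack_succ d hb]
    by_cases hpred : ∀ w, (τ i).edge w v → JobCompleted B S ⟨i, j, w⟩ b
    · have hinc' : ¬ JobCompleted B S ⟨i, j, v⟩ b := fun h => hinc (h.mono b.le_succ)
      obtain ⟨l, hl, hle⟩ := ih v hinc'
      refine ⟨l, hl, ?_⟩
      rw [service_succ]
      by_cases h : urgentCount B S d b < M
      · have hready : Ready B S ⟨i, j, v⟩ b :=
          ⟨hb, hinc', hpred, fun j' hj' => (hprev j' hj').mono hb⟩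
        rw [if_pos h, if_pos (hready.mem_of_urgentCount_lt hS hd h)]
        omega
      · rw [if_neg h]
        omega
    -- An incomplete predecessor `w` has service below its WCET; appending `w` to the chain thus
    -- leaves a unit to pay for slot `b`.
    · push Not at hpred
      obtain ⟨w, hw, hwinc⟩ := hpred
      obtain ⟨l, hl, hle⟩ := ih w hwinc
      refine ⟨l ++ [w], ?_, ?_⟩
      · unfold DagTask.IsChain at hl ⊢
        rw [List.isChain_append]
        refine ⟨hl, by simp, ?_⟩
        simpa using hw
      · have h₁ : service S ⟨i, j, w⟩ b < B.exec ⟨i, j, w⟩ := not_le.1 hwinc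
        have h₂ : B.exec ⟨i, j, w⟩ ≤ (τ i).wcet w := B.exec_le_wcet ⟨i, j, w⟩
        simp only [DagTask.chainLength, List.map_append, List.sum_append, List.map_cons,
          List.map_nil, List.sum_cons, List.sum_nil] at hle ⊢
        split_ifs <;> omega

/-- The chain ends in an incomplete job, whose service is below its WCET; hence the strict
inequality. -/
theorem slack_lt_chainLength (hS : IsCPGEDFSchedule M cp B S) {i : Fin n} {j d b : ℕ}
    (hcp : (τ i).IsCriticalPath (cp i))
    (hd : B.deadline i j ≤ d) (hprev : ∀ j' < j, DagJobCompleted B S i j' (B.release i j))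
    (hb : B.release i j ≤ b) (hinc : ¬ DagJobCompleted B S i j b) :
    slack M B S d (B.release i j) b < (τ i).chainLength (cp i) := by
  simp only [DagJobCompleted, not_forall] at hinc
  obtain ⟨v, hv⟩ := hinc
  obtain ⟨l, hl, hle⟩ := exists_chain_slack_le hS hd hprev hb v hv
  refine lt_of_lt_of_le ?_ (hcp.2 _ hl)
  have h₁ : service S ⟨i, j, v⟩ b < B.exec ⟨i, j, v⟩ := not_le.1 hv
  have h₂ : B.exec ⟨i, j, v⟩ ≤ (τ i).wcet v := B.exec_le_wcet ⟨i, j, v⟩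
  simp only [DagTask.chainLength, List.map_append, List.sum_append, List.map_cons,
    List.map_nil, List.sum_cons, List.sum_nil] at hle ⊢
  omega

theorem dagRemaining_le (hS : IsCPGEDFSchedule M cp B S) (i : Fin n) (j t : ℕ) :
    dagRemaining B S i j t ≤ (τ i).totalExec :=
  le_of_add_le_left (dagRemaining_add_sum_service_le hS i j t)

/-! ### Demand of a single task -/

/-- If `j` is the first dag-job of task `i` pending at `t`, then the demand of the task is that of
`j` together with those of the later dag-jobs that fit before `d`. -/
theorem exists_demand_le (himplicit : ∀ i, (τ i).relDeadline = (τ i).period)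
    (hS : IsCPGEDFSchedule M cp B S) {i : Fin n} {j d t : ℕ} (hd : B.deadline i j ≤ d)
    (hfirst : ∀ j' < j, dagRemaining B S i j' t = 0) :
    ∃ m : ℕ, B.release i j + (m + 1) * (τ i).period ≤ d ∧
      demand B S d i t ≤ dagRemaining B S i j t + m * (τ i).totalExec := by
  have hp := (τ i).period_pos
  rw [Behaviour.deadline, himplicit] at hd
  -- `m + 1` is the number of whole periods between the release of `j` and `d`.
  obtain ⟨m, hm⟩ : ∃ m, (d - B.release i j) / (τ i).period = m + 1 :=
    Nat.exists_eq_succ_of_ne_zero (Nat.div_pos (by omega) hp).ne'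
  refine ⟨m, ?_, ?_⟩
  · have := Nat.div_mul_le_self (d - B.release i j) (τ i).period
    rw [hm] at this
    omega
  · have hsub : ∀ j' ∈ urgentIndices B d i, j' ∉ Finset.Ico j (j + (m + 1)) →
        dagRemaining B S i j' t = 0 := by
      intro j' hj' hnot
      refine hfirst j' ?_
      by_contra hge
      obtain ⟨q, rfl⟩ := Nat.exists_eq_add_of_le (not_lt.1 hge)
      rw [mem_urgentIndices himplicit, Behaviour.deadline, himplicit] at hj'
      have h₁ := release_add_mul_le B i j q
      have h₂ : q + 1 ≤ (d - B.release i j) / (τ i).period := by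
        rw [Nat.le_div_iff_mul_le hp, add_mul]
        omega
      exact hnot (Finset.mem_Ico.2 ⟨by omega, by omega⟩)
    calc demand B S d i t
        ≤ ∑ j' ∈ Finset.Ico j (j + (m + 1)), dagRemaining B S i j' t := by
          unfold demand
          exact Finset.sum_le_sum_of_ne_zero fun j' hj' h0 => by
            by_contra hnot
            exact h0 (hsub j' hj' hnot)
      _ = dagRemaining B S i j t +
            ∑ j' ∈ Finset.Ico (j + 1) (j + (m + 1)), dagRemaining B S i j' t :=
          Finset.sum_eq_sum_Ico_succ_bot (by omega) _
      _ ≤ dagRemaining B S i j t + m * (τ i).totalExec := by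
          refine Nat.add_le_add_left ?_ _
          refine (Finset.sum_le_card_nsmul _ _ _ fun j' _ => dagRemaining_le hS i j' t).trans ?_
          rw [Nat.card_Ico, smul_eq_mul]
          exact Nat.mul_le_mul_right _ (by omega)

theorem utilization_nonneg (T : DagTask.{u}) : 0 ≤ T.utilization := by
  unfold DagTask.utilization
  positivity

theorem utilization_mul_period (T : DagTask.{u}) :
    T.utilization * T.period = T.totalExec :=
  div_mul_cancel₀ _ (Nat.cast_ne_zero.2 T.period_pos.ne')

/-- The window bound on `η`: a carry-in dag-job released `φ` before a window of length `Δ` that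
has received `λ φ` units of execution costs at most `η Δ`. -/
theorem le_eta_mul {k i : Fin n} {Δ φ : ℝ} (hΔ : ((τ k).period : ℝ) ≤ Δ) (hφ₀ : 0 ≤ φ)
    (hφ : φ ≤ (τ i).period) :
    (τ i).utilization * (Δ + φ) - (τ k).cpUtilization (cp k) * φ ≤ eta τ cp k i * Δ := by
  have hpk : (0 : ℝ) < (τ k).period := Nat.cast_pos.2 (τ k).period_pos
  unfold eta
  split_ifs with h
  · nlinarith [mul_le_mul_of_nonneg_right h hφ₀]
  · rw [not_le] at h
    rw [← utilization_mul_period (τ i), ← sub_mul, add_mul]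
    set x := (τ i).utilization - (τ k).cpUtilization (cp k) with hx
    have hx₀ : 0 ≤ x * (τ i).period := mul_nonneg (by linarith) (Nat.cast_nonneg _)
    -- The excess `x * φ` is largest at φ = p_i; since p_k ≤ Δ, it can be charged to the window at
    -- rate `x` p_i / p_k, the extra term of `eta`.
    have h₁ : x * φ ≤ x * (τ i).period := mul_le_mul_of_nonneg_left hφ (by linarith)
    have h₂ : x * (τ i).period ≤ x * (τ i).period / (τ k).period * Δ := by
      rw [div_mul_eq_mul_div, le_div_iff₀ hpk]
      exact mul_le_mul_of_nonneg_left hΔ hx₀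
    rw [hx] at h₁ h₂ ⊢
    nlinarith

/-- The demand of one task at the start `t` of a maximal busy window `[t, d)`. -/
theorem demand_le_eta_mul (himplicit : ∀ i, (τ i).relDeadline = (τ i).period)
    (hS : IsCPGEDFSchedule M cp B S) (hM : 1 ≤ M) {d t : ℕ} (k i : Fin n)
    (hmeet : ∀ j, B.deadline i j < d → DagJobCompleted B S i j (B.deadline i j))
    (hkd : t + (τ k).period ≤ d)
    (hbusy : ((M : ℝ) - ((M : ℝ) - 1) * (τ k).cpUtilization (cp k)) * ((d : ℝ) - t) <
      ((∑ i', demand B S d i' t : ℕ) : ℝ))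
    (hmax : ∀ s < t, ((∑ i', demand B S d i' s : ℕ) : ℝ) ≤
      ((M : ℝ) - ((M : ℝ) - 1) * (τ k).cpUtilization (cp k)) * ((d : ℝ) - s)) :
    (demand B S d i t : ℝ) ≤ eta τ cp k i * ((d : ℝ) - t) := by
  classical
  have hΔ : ((τ k).period : ℝ) ≤ (d : ℝ) - t := by
    have : ((t + (τ k).period : ℕ) : ℝ) ≤ d := Nat.cast_le.2 hkd
    push_cast at this
    linarith
  have hΔ₀ : (0 : ℝ) ≤ (d : ℝ) - t := le_trans (Nat.cast_nonneg _) hΔ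
  -- The case φ = 0, u_i Δ ≤ η_i Δ, serves tasks without carry-in.
  have hzero := le_eta_mul (cp := cp) (i := i) hΔ le_rfl (Nat.cast_nonneg _)
  rw [add_zero, mul_zero, sub_zero] at hzero
  by_cases hex : ∃ j, B.deadline i j ≤ d ∧ dagRemaining B S i j t ≠ 0
  swap
  · push Not at hex
    have : demand B S d i t = 0 :=
      Finset.sum_eq_zero fun j hj => hex j ((mem_urgentIndices himplicit).1 hj)
    rw [this, Nat.cast_zero]
    exact (mul_nonneg (utilization_nonneg _) hΔ₀).trans hzero
  obtain ⟨hjd, hjne⟩ := Nat.find_spec hex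
  have hjmin : ∀ j' < Nat.find hex, ¬ (B.deadline i j' ≤ d ∧ dagRemaining B S i j' t ≠ 0) :=
    fun j' hj' => Nat.find_min hex hj'
  generalize Nat.find hex = j at hjd hjne hjmin
  have hdl : ∀ j, B.deadline i j = B.release i j + (τ i).period := fun j => by
    rw [Behaviour.deadline, himplicit]
  have hp := (τ i).period_pos
  have hfirst : ∀ j' < j, dagRemaining B S i j' t = 0 := by
    intro j' hj'
    by_contra h
    refine hjmin j' hj' ⟨?_, h⟩
    have := release_add_period_le B i hj'
    rw [hdl] at hjd ⊢
    omega
  obtain ⟨m, hm, hdem⟩ := exists_demand_le himplicit hS hjd hfirst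
  have hinc : ¬ DagJobCompleted B S i j t := fun h =>
    hjne (dagJobCompleted_iff_dagRemaining_eq_zero.1 h)
  have hm' : (B.release i j : ℝ) + (m + 1) * (τ i).period ≤ d := by exact_mod_cast hm
  have hdem' : (demand B S d i t : ℝ) ≤ dagRemaining B S i j t + m * (τ i).totalExec := by
    exact_mod_cast hdem
  have hC := utilization_mul_period (τ i)
  have hu := utilization_nonneg (τ i)
  have hfit : ((m : ℝ) + 1) * (τ i).totalExec ≤ (τ i).utilization * (d - B.release i j) := by
    rw [← hC]
    nlinarith [mul_le_mul_of_nonneg_left hm' hu]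
  rcases le_or_gt t (B.release i j) with hrt | hrt
  · have h₁ : (dagRemaining B S i j t : ℝ) ≤ (τ i).totalExec :=
      Nat.cast_le.2 (dagRemaining_le hS i j t)
    have h₂ : (t : ℝ) ≤ B.release i j := Nat.cast_le.2 hrt
    refine le_trans ?_ hzero
    nlinarith [mul_le_mul_of_nonneg_left h₂ hu]
  · have hprev : ∀ j' < j, DagJobCompleted B S i j' (B.release i j) := by
      intro j' hj'
      have h₁ := release_add_period_le B i hj'
      have h₂ := hdl j'
      exact (hmeet j' (by omega)).mono (by omega)
    -- A deadline at or before `t < d` would have been met; so φ ≤ p_i below.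
    have hjt : t < B.deadline i j := by
      by_contra h
      have := (τ k).period_pos
      exact hinc ((hmeet j (by omega)).mono (not_lt.1 h))
    have hserv := slack_le_sum_service hS hjd hprev hrt.le hinc
    have htot := dagRemaining_add_sum_service_le hS i j t
    have hdrop := sum_demand_add_le himplicit hS hjd hprev hrt.le hinc
    have hearly := hmax _ hrt
    set N := slack M B S d (B.release i j) t
    have hdrop' : ((∑ i', demand B S d i' t : ℕ) : ℝ) + M * ((t : ℝ) - B.release i j) + N ≤
        ((∑ i', demand B S d i' (B.release i j) : ℕ) : ℝ) + M * N := by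
      rw [← Nat.cast_sub hrt.le]
      exact_mod_cast hdrop
    -- Demand fell by at least Mφ - (M-1)`N` but by less than μφ. For `M = 1` these bounds already
    -- conflict.
    have hN : (τ k).cpUtilization (cp k) * ((t : ℝ) - B.release i j) < N := by
      have hM' : (0 : ℝ) ≤ (M : ℝ) - 1 := by
        rw [sub_nonneg]
        exact_mod_cast hM
      refine lt_of_mul_lt_mul_left ?_ hM'
      nlinarith
    have htot' : (dagRemaining B S i j t : ℝ) + N ≤ (τ i).totalExec := by
      exact_mod_cast (Nat.add_le_add_left hserv _).trans htot
    have hrt' : (B.release i j : ℝ) ≤ t := Nat.cast_le.2 hrt.le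
    have hφ : (t : ℝ) - B.release i j ≤ (τ i).period := by
      rw [hdl] at hjt
      have : (t : ℝ) ≤ ((B.release i j + (τ i).period : ℕ) : ℝ) := Nat.cast_le.2 hjt.le
      push_cast at this
      linarith
    have hwin := le_eta_mul (cp := cp) (i := i) hΔ (sub_nonneg.2 hrt') hφ
    rw [sub_add_sub_cancel] at hwin
    linarith

end

end CPGEDF

theorem theorem1 {n : ℕ} (M : ℕ) (hM : 1 ≤ M) (τ : Fin n → CPGEDF.DagTask.{u})
    (himplicit : ∀ i, (τ i).relDeadline = (τ i).period)
    (cp : ∀ i, List (τ i).Subtask) (hcp : ∀ i, (τ i).IsCriticalPath (cp i))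
    (htest : ∀ k : Fin n,
      ∑ i, CPGEDF.eta τ cp k i ≤ (M : ℝ) - ((M : ℝ) - 1) * (τ k).cpUtilization (cp k)) :
    CPGEDF.Schedulable M τ cp := by
  open CPGEDF in
  intro B S hS
  classical
  by_contra hmiss
  have hex : ∃ d i j, B.deadline i j = d ∧ ¬ DagJobCompleted B S i j d := by
    push Not at hmiss
    obtain ⟨i, j, h⟩ := hmiss
    exact ⟨_, i, j, rfl, h⟩
  obtain ⟨k, q, hd, hinc⟩ := Nat.find_spec hex
  have hmeet : ∀ i j, B.deadline i j < Nat.find hex →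
      DagJobCompleted B S i j (B.deadline i j) := by
    intro i j hlt
    by_contra h
    exact Nat.find_min hex hlt ⟨i, j, rfl, h⟩
  generalize Nat.find hex = d at hd hinc hmeet
  have hdl : ∀ i j, B.deadline i j = B.release i j + (τ i).period := fun i j => by
    rw [Behaviour.deadline, himplicit]
  have hpk := (τ k).period_pos
  have hrd : B.release k q + (τ k).period = d := by rw [← hd, hdl]
  have hprev : ∀ j' < q, DagJobCompleted B S k j' (B.release k q) := by
    intro j' hj'
    have h₁ := release_add_period_le B k hj'
    have h₂ := hdl k j'
    exact (hmeet k j' (by omega)).mono (by omega)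
  have hM' : (0 : ℝ) ≤ (M : ℝ) - 1 := by
    rw [sub_nonneg]
    exact_mod_cast hM
  -- This leftover unit makes `hbusy` strict, even for `M = 1`.
  have hpos : 1 ≤ ∑ i, demand B S d i d := by
    have h₁ : 0 < dagRemaining B S k q d :=
      Nat.pos_of_ne_zero fun h => hinc (dagJobCompleted_iff_dagRemaining_eq_zero.2 h)
    have h₂ : dagRemaining B S k q d ≤ demand B S d k d :=
      Finset.single_le_sum (f := fun j => dagRemaining B S k j d) (fun _ _ => Nat.zero_le _)
        ((mem_urgentIndices himplicit).2 hd.le)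
    have h₃ : demand B S d k d ≤ ∑ i, demand B S d i d :=
      Finset.single_le_sum (f := fun i => demand B S d i d) (fun _ _ => Nat.zero_le _)
        (Finset.mem_univ k)
    omega
  have hbusy : ∃ t, t ≤ B.release k q ∧
      ((M : ℝ) - ((M : ℝ) - 1) * (τ k).cpUtilization (cp k)) * ((d : ℝ) - t) <
        ((∑ i, demand B S d i t : ℕ) : ℝ) := by
    refine ⟨B.release k q, le_rfl, ?_⟩
    have hdrop := sum_demand_add_le himplicit hS hd.le hprev (by omega) hinc
    have hN := slack_lt_chainLength hS (hcp k) hd.le hprev (by omega) hinc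
    set N := slack M B S d (B.release k q) d
    rw [show d - B.release k q = (τ k).period by omega] at hdrop
    have hdrop' : (1 : ℝ) + M * (τ k).period + N ≤
        ((∑ i, demand B S d i (B.release k q) : ℕ) : ℝ) + M * N := by
      exact_mod_cast le_trans (by omega) hdrop
    have hN' : (N : ℝ) ≤ (τ k).chainLength (cp k) := Nat.cast_le.2 hN.le
    have hσ : (τ k).cpUtilization (cp k) * (τ k).period = (τ k).chainLength (cp k) :=
      div_mul_cancel₀ _ (Nat.cast_ne_zero.2 hpk.ne')
    have hlen : (d : ℝ) - B.release k q = (τ k).period := by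
      rw [← hrd]
      push_cast
      ring
    rw [hlen, sub_mul, mul_assoc, hσ]
    nlinarith [mul_le_mul_of_nonneg_left hN' hM']
  obtain ⟨htr, htb⟩ := Nat.find_spec hbusy
  have hmax : ∀ s < Nat.find hbusy, ((∑ i, demand B S d i s : ℕ) : ℝ) ≤
      ((M : ℝ) - ((M : ℝ) - 1) * (τ k).cpUtilization (cp k)) * ((d : ℝ) - s) := by
    intro s hs
    by_contra h
    exact Nat.find_min hbusy hs ⟨by omega, not_le.1 h⟩
  generalize Nat.find hbusy = t at htr htb hmax
  have hwindow : (0 : ℝ) ≤ (d : ℝ) - t := sub_nonneg.2 (Nat.cast_le.2 (by omega))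
  have hsum : ((∑ i, demand B S d i t : ℕ) : ℝ) ≤ (∑ i, eta τ cp k i) * ((d : ℝ) - t) := by
    rw [Nat.cast_sum, Finset.sum_mul]
    exact Finset.sum_le_sum fun i _ =>
      demand_le_eta_mul himplicit hS hM k i (hmeet i) (by omega) htb hmax
  exact absurd (hsum.trans (mul_le_mul_of_nonneg_right (htest k) hwindow)) (not_le.2 htb)
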